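/- Let $d\ge 0$ and let $\mathcal Q\subseteq\mathbb R^d$ be a configuration space: either $\mathcal Q=\mathbb R^d$, or $\mathcal Q=\mathbb R^d\setminus\bigcup_{\ell=1}^m S_\ell$, where each $S_\ell\subseteq\mathbb R^d$ is closed and admissible, i.e. for some $\delta>0$ the function $q\mapsto\operatorname{dist}(q,S_\ell)$ is differentiable on $\{q: \operatorname{dist}(q,S_\ell)<\delta\}\setminus S_\ell$. Let $j=(j^0,J)$ be a $C^1$ vector field on $\mathbb R\times\mathcal Q$, with $j^0$ real-valued and $J$ taking values in $\mathbb R^d$, such that $\partial_t j^0+\sum_{i=1}^d\partial_{q_i}J_i=0$ on $\mathbb R\times\mathcal Q$, and $j^0>0$ at every point where $j\neq0$. (No normalization of $j^0$ is assumed.) The zeros of $j$ are called nodes. For $q\in\mathcal Q$ with $j(0,q)\ne0$ let $Q_q$, defined on $(\tau_q^-,\tau_q^+)\ni 0$, be the maximal solution of $$\frac{dQ}{dt}(t)=\frac{J(t,Q(t))}{j^0(t,Q(t))},\qquad Q(0)=q,$$ in $(\mathbb R\times\mathcal Q)\setminus\{j=0\}$. Adjoin a cemetery point $\dagger$ to $\mathcal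 Q$ (a subset of $\mathcal Q\cup\{\dagger\}$ is measurable iff its intersection with $\mathcal Q$ is Borel) and define the flow map $\varphi_t:\mathcal Q\to\mathcal Q\cup\{\dagger\}$, $t\in\mathbb R$, as follows. If $j(0,q)\neq0$, then $\varphi_t(q)=Q_q(t)$ for $t\in(\tau_q^-,\tau_q^+)$ and $\varphi_t(q)=\dagger$ otherwise; if $j(0,q)=0$, then $\varphi_0(q)=q$ and $\varphi_t(q)=\dagger$ for all $t\ne0$. Let $\operatorname{Im}\varphi_t=\varphi_t(\mathcal Q)\cap\mathcal Q$, let $\mu_t$ be the (possibly infinite) measure $\mu_t(B)=\int_B j^0(t,q)\,dq$ on the Borel subsets of $\mathcal Q$, and let $\rho_t=\mu_0\circ\varphi_t^{-1}$ be the pushforward of $\mu_0$ under $\varphi_t$. Then for every $t\in\mathbb R$ the map $\varphi_t$ is measurable, the set $\operatorname{Im}\varphi_t$ is Borel, and for every Borel set $B\subseteq\mathcal Q$ $$\rho_t(B)=\mu_t\bigl(B\cap\operatorname{Im}\varphi_t\bigr).$$ -/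

import Mathlib

open MeasureTheory Set

noncomputable section

namespace BohmFlow

/-- The Euclidean space `ℝ^d`. -/
abbrev Space (d : ℕ) : Type := EuclideanSpace ℝ (Fin d)

/-- A closed set is admissible if, for some `δ > 0`, the distance to it is differentiable on its
open `δ`-neighbourhood minus the set itself. -/
def IsAdmissible {d : ℕ} (S : Set (Space d)) : Prop :=
  IsClosed S ∧ ∃ δ : ℝ, 0 < δ ∧
    DifferentiableOn ℝ (fun q => Metric.infDist q S) (Metric.thickening δ S \ S)

/-- Configuration spaces: `ℝ^d`, or `ℝ^d` minus finitely many admissible sets. -/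
def IsConfigurationSpace {d : ℕ} (C : Set (Space d)) : Prop :=
  C = univ ∨ ∃ (m : ℕ) (S : Fin m → Set (Space d)), (∀ l, IsAdmissible (S l)) ∧
    C = univ \ ⋃ l, S l

/-- The space-time divergence `∂₀ j⁰ + ∑ i, ∂ᵢ Jᵢ` of `j = (j⁰, J)` at the point `x = (t, q)`. -/
def divergence {d : ℕ} (j : ℝ × Space d → ℝ × Space d) (x : ℝ × Space d) : ℝ :=
  (fderiv ℝ j x (1, 0)).1 + ∑ i : Fin d, (fderiv ℝ j x (0, EuclideanSpace.single i 1)).2 i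

/-- `j = (j⁰, J)` is a `C¹` divergence-free vector field on `ℝ × C` with `j⁰ > 0` wherever
`j ≠ 0`. Only the values of `j` on `ℝ × C` matter. -/
structure IsCurrent {d : ℕ} (C : Set (Space d)) (j : ℝ × Space d → ℝ × Space d) : Prop where
  contDiffOn : ContDiffOn ℝ 1 j (univ ×ˢ C)
  divergence_eq_zero : ∀ t : ℝ, ∀ q ∈ C, divergence j (t, q) = 0
  pos : ∀ t : ℝ, ∀ q ∈ C, j (t, q) ≠ 0 → 0 < (j (t, q)).1

/-- `Q` solves `dQ/dt = J(t, Q) / j⁰(t, Q)` on the open interval `(a, b)` containing `0`, with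
`Q(0) = q`; the right-hand side lives on `ℝ × C` minus the nodes (the zeros of `j`), so the
graph of `Q` has to stay there. -/
structure IsSolution {d : ℕ} (C : Set (Space d)) (j : ℝ × Space d → ℝ × Space d)
    (q : Space d) (a b : ℝ) (Q : ℝ → Space d) : Prop where
  zero_mem : (0 : ℝ) ∈ Ioo a b
  initial : Q 0 = q
  mem : ∀ s ∈ Ioo a b, Q s ∈ C
  ne_node : ∀ s ∈ Ioo a b, j (s, Q s) ≠ 0
  hasDerivAt : ∀ s ∈ Ioo a b,
    HasDerivAt Q ((j (s, Q s)).1⁻¹ • (j (s, Q s)).2) s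

/-- The configuration space with the cemetery configuration (`none`) adjoined. -/
abbrev WithCemetery {d : ℕ} (C : Set (Space d)) : Type := Option C

/-- A set is measurable iff its part in the configuration space is Borel. -/
instance {d : ℕ} (C : Set (Space d)) : MeasurableSpace (WithCemetery C) :=
  MeasurableSpace.map some inferInstance

open Classical in
/-- The flow map `φ_t(q) = Q_q(t)`. The domain of the maximal solution `Q_q` is the union of the
open intervals around `0` that carry a solution starting in `q`, and on each of them `Q_q` is
that solution (for a `C¹` field any two agree on their common interval, so the choice is
immaterial). Outside that domain `φ_t(q)` is the cemetery, except that `φ_0(q) = q`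
also when `(0, q)` is a node. -/
def flow {d : ℕ} (C : Set (Space d)) (j : ℝ × Space d → ℝ × Space d) (t : ℝ) (q : C) :
    WithCemetery C :=
  if h : ∃ p : C, ∃ (a b : ℝ) (Q : ℝ → Space d),
      IsSolution C j q a b Q ∧ t ∈ Ioo a b ∧ Q t = p then some h.choose
  else if t = 0 then some q
  else none

/-- The part `φ_t(C) ∩ C` of the image of `φ_t` that lies in the configuration space. -/
def flowImage {d : ℕ} (C : Set (Space d)) (j : ℝ × Space d → ℝ × Space d) (t : ℝ) : Set C :=
  some ⁻¹' range (flow C j t)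

/-- The measure `μ_t` on the configuration space with Lebesgue density `j⁰(t, ·)`. -/
def densityMeasure {d : ℕ} (C : Set (Space d)) (j : ℝ × Space d → ℝ × Space d) (t : ℝ) :
    Measure C :=
  ((volume : Measure (Space d)).comap Subtype.val).withDensity fun q => ENNReal.ofReal (j (t, (q : Space d))).1

/-- The distribution `ρ_t = μ_0 ∘ φ_t⁻¹` of `Q_q(t)` if `q` has distribution `μ_0`. -/
def flowMeasure {d : ℕ} (C : Set (Space d)) (j : ℝ × Space d → ℝ × Space d) (t : ℝ) :
    Measure (WithCemetery C) :=
  (densityMeasure C j 0).map (flow C j t)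

end BohmFlow

end

/-! Off the nodes the velocity $v=J/j^0$ is $C^1$ on an open set. Over a compact time interval a
trajectory has a compact graph, near which $v$ equals a compactly supported $C^1$ field; so the
time-$t$ map is defined on an open set $U_t$, differentiable there, and injective by uniqueness
(`IsSolution.exists_local_flow`, `IsSolution.eq_of_eq`). Along a trajectory Liouville's formula
gives $D'=(\operatorname{div}v)D$ for the Jacobian determinant, while the continuity equation gives
$\frac{d}{dt}j^0=-(\operatorname{div}v)j^0$. Hence $D\cdot j^0(t,Q(t))=j^0(0,q)$, and change of
variables yields $\mu_0(S)=\mu_t(\varphi_t(S))$ for Borel $S\subseteq U_t$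
(`lintegral_position_image`). For $t\ne0$ take $S=U_t\cap\varphi_t^{-1}(B)$, whose image is
$B\cap\operatorname{Im}\varphi_t$; for $t=0$ the flow is the identity. -/

noncomputable section

open Filter Topology NNReal

namespace BohmFlow

/-! ### Grönwall estimates -/

section Gronwall

variable {E : Type*} [NormedAddCommGroup E] [NormedSpace ℝ E]

/-- Grönwall's inequality in both time directions. -/
theorem norm_le_gronwallBound_of_mem_uIcc {f f' : ℝ → E} {K ε a b : ℝ}
    (hf : ∀ s ∈ uIcc a b, HasDerivAt f (f' s) s)
    (bound : ∀ s ∈ uIcc a b, ‖f' s‖ ≤ K * ‖f s‖ + ε) :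
    ‖f b‖ ≤ gronwallBound ‖f a‖ K ε |b - a| := by
  rcases le_total a b with h | h
  · rw [uIcc_of_le h] at hf bound
    rw [abs_of_nonneg (sub_nonneg.2 h)]
    exact norm_le_gronwallBound_of_norm_deriv_right_le
      (fun s hs => (hf s hs).continuousAt.continuousWithinAt)
      (fun s hs => (hf s (Ico_subset_Icc_self hs)).hasDerivWithinAt) le_rfl
      (fun s hs => bound s (Ico_subset_Icc_self hs)) b (right_mem_Icc.2 h)
  -- Time reversal: the forward estimate for `s ↦ f (-s)` on `[-a, -b]`.
  · rw [uIcc_of_ge h] at hf bound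
    have hmem : ∀ s ∈ Icc (-a) (-b), -s ∈ Icc b a := fun s hs =>
      ⟨by linarith [hs.2], by linarith [hs.1]⟩
    have hd : ∀ s ∈ Icc (-a) (-b), HasDerivAt (fun s => f (-s)) (-f' (-s)) s := fun s hs => by
      simpa [Function.comp_def] using (hf (-s) (hmem s hs)).scomp s (hasDerivAt_neg s)
    have := norm_le_gronwallBound_of_norm_deriv_right_le (f := fun s => f (-s))
      (f' := fun s => -f' (-s)) (δ := ‖f a‖) (K := K) (ε := ε) (a := -a) (b := -b)
      (fun s hs => (hd s hs).continuousAt.continuousWithinAt)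
      (fun s hs => (hd s (Ico_subset_Icc_self hs)).hasDerivWithinAt) (by simp)
      (fun s hs => by simpa using bound _ (hmem s (Ico_subset_Icc_self hs)))
      (-b) (right_mem_Icc.2 (neg_le_neg h))
    rw [abs_of_nonpos (sub_nonpos.2 h)]
    have e : -b - -a = -(b - a) := by ring
    simpa [e] using this

theorem gronwallBound_le {δ K ε x T : ℝ} (hδ : 0 ≤ δ) (hε : 0 ≤ ε) (hK : 0 < K) (hx : x ≤ T) :
    gronwallBound δ K ε x ≤ (δ + ε / K) * Real.exp (K * T) := by
  rw [gronwallBound_of_K_ne_0 hK.ne']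
  have h1 : Real.exp (K * x) ≤ Real.exp (K * T) := Real.exp_le_exp.2 (by gcongr)
  have h2 : 0 ≤ ε / K := by positivity
  have := mul_le_mul_of_nonneg_left h1 (add_nonneg hδ h2)
  dsimp only
  nlinarith

theorem norm_le_of_gronwall {f f' : ℝ → E} {K ε a b T : ℝ} (hK : 0 < K) (hε : 0 ≤ ε)
    (hT : |b - a| ≤ T)
    (hf : ∀ s ∈ uIcc a b, HasDerivAt f (f' s) s)
    (bound : ∀ s ∈ uIcc a b, ‖f' s‖ ≤ K * ‖f s‖ + ε) :
    ‖f b‖ ≤ (‖f a‖ + ε / K) * Real.exp (K * T) :=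
  (norm_le_gronwallBound_of_mem_uIcc hf bound).trans
    (gronwallBound_le (norm_nonneg _) hε hK hT)

theorem uIcc_zero_subset_Ioo {T t : ℝ} (ht : t ∈ Ioo (-T) T) : uIcc 0 t ⊆ Ioo (-T) T :=
  ordConnected_Ioo.uIcc_subset ⟨by linarith [ht.1, ht.2], by linarith [ht.1, ht.2]⟩ ht

/-- Two solutions of a Lipschitz equation diverge at most exponentially. -/
theorem norm_sub_le_of_solutions {w : ℝ → E → E} {K : ℝ≥0} (hK : 0 < K)
    (hw : ∀ s, LipschitzWith K (w s)) {f g : ℝ → E} {a b T : ℝ} (hT : |b - a| ≤ T)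
    (hf : ∀ s ∈ uIcc a b, HasDerivAt f (w s (f s)) s)
    (hg : ∀ s ∈ uIcc a b, HasDerivAt g (w s (g s)) s) :
    ‖f b - g b‖ ≤ ‖f a - g a‖ * Real.exp (K * T) := by
  have := norm_le_of_gronwall (f := fun s => f s - g s)
    (f' := fun s => w s (f s) - w s (g s)) (K := K) (ε := 0) (a := a) (b := b) (T := T)
    (by exact_mod_cast hK) le_rfl hT (fun s hs => (hf s hs).sub (hg s hs)) (fun s _ => by
      simpa [dist_eq_norm] using (hw s).dist_le_mul (f s) (g s))
  simpa using this

end Gronwall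

/-! ### Existence of solutions on a prescribed interval -/

section Existence

variable {E : Type*} [NormedAddCommGroup E] [NormedSpace ℝ E] [CompleteSpace E]

/-- Since the bounds are global in space, the Picard–Lindelöf ball may have radius `L * T`, which no
solution leaves before time `T`. -/
theorem exists_solution_of_bounded {w : ℝ → E → E} {K L : ℝ≥0} {T : ℝ} (hT : 0 < T)
    (hlip : ∀ s ∈ Icc (-T) T, LipschitzWith K (w s))
    (hcont : ∀ x, ContinuousOn (fun s => w s x) (Icc (-T) T))
    (hbound : ∀ s ∈ Icc (-T) T, ∀ x, ‖w s x‖ ≤ L) (q : E) :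
    ∃ Q : ℝ → E, Q 0 = q ∧ ∀ s ∈ Ioo (-T) T, HasDerivAt Q (w s (Q s)) s := by
  have h0 : (0 : ℝ) ∈ Icc (-T) T := ⟨by linarith, hT.le⟩
  have hPL : IsPicardLindelof w (⟨0, h0⟩ : Icc (-T) T) q (L * T.toNNReal) 0 L K :=
    { lipschitzOnWith := fun s hs => (hlip s hs).lipschitzOnWith
      continuousOn := fun x _ => hcont x
      norm_le := fun s hs x _ => hbound s hs x
      mul_max_le := by simp [Real.coe_toNNReal _ hT.le] }
  obtain ⟨Q, hQ0, hQ⟩ := hPL.exists_eq_forall_mem_Icc_hasDerivWithinAt₀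
  exact ⟨Q, hQ0, fun s hs => (hQ s (Ioo_subset_Icc_self hs)).hasDerivAt (Icc_mem_nhds hs.1 hs.2)⟩

/-- A linear field is unbounded, so it is cut off to `A s (χ x • x)`. Grönwall keeps the truncated
solution in the ball of radius `R`, where `χ = 1` and the cutoff is invisible. -/
theorem exists_solution_of_linear {F : Type*} [NormedAddCommGroup F] [NormedSpace ℝ F]
    [FiniteDimensional ℝ F] {A : ℝ → F →L[ℝ] F} {T : ℝ} (hT : 0 < T)
    (hA : ContinuousOn A (Icc (-T) T)) (y : F) :
    ∃ Y : ℝ → F, Y 0 = y ∧ ∀ s ∈ Ioo (-T) T, HasDerivAt Y (A s (Y s)) s := by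
  have : CompleteSpace F := FiniteDimensional.complete ℝ F
  obtain ⟨k, hk⟩ := isCompact_Icc.exists_bound_of_continuousOn hA
  set K : ℝ≥0 := k.toNNReal + 1 with hKdef
  have hK0 : (0 : ℝ) < K := by positivity
  have hK : ∀ s ∈ Icc (-T) T, ‖A s‖ ≤ K := fun s hs => (hk s hs).trans <| by
    rw [hKdef]; push_cast; linarith [Real.le_coe_toNNReal k]
  set R : ℝ := ‖y‖ * Real.exp (K * T) + 1 with hR
  have hR0 : 0 < R := by positivity
  let χ : ContDiffBump (0 : F) := ⟨R, R + 1, hR0, by linarith⟩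
  let ρ : F → F := fun x => χ x • x
  have hρc : HasCompactSupport ρ := χ.hasCompactSupport.smul_right
  have hρd : ContDiff ℝ 1 ρ := χ.contDiff.smul contDiff_id
  obtain ⟨c, hc⟩ := hρd.lipschitzWith_of_hasCompactSupport hρc one_ne_zero
  obtain ⟨b, hb⟩ := hρc.exists_bound_of_continuous hρd.continuous
  have hρn : ∀ x, ‖ρ x‖ ≤ ‖x‖ := fun x => by
    simp only [ρ, norm_smul, Real.norm_eq_abs, abs_of_nonneg χ.nonneg]
    exact mul_le_of_le_one_left (norm_nonneg _) χ.le_one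
  obtain ⟨Y, hY0, hY⟩ := exists_solution_of_bounded (w := fun s x => A s (ρ x)) (K := K * c)
    (L := K * b.toNNReal) hT
    (fun s hs => ((A s).lipschitz.weaken (by exact_mod_cast hK s hs)).comp hc)
    (fun x => hA.clm_apply continuousOn_const)
    (fun s hs x => ((A s).le_opNorm _).trans <| by
      push_cast
      exact mul_le_mul (hK s hs) ((hb x).trans (Real.le_coe_toNNReal b)) (norm_nonneg _) hK0.le) y
  refine ⟨Y, hY0, fun s hs => ?_⟩
  have hbd : ‖Y s‖ ≤ ‖y‖ * Real.exp (K * T) := by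
    have hsub := uIcc_zero_subset_Ioo hs
    have := norm_le_of_gronwall (f := Y) (f' := fun s => A s (ρ (Y s))) (K := K) (ε := 0) (a := 0)
      (b := s) (T := T) hK0 le_rfl (by simpa [abs_le] using ⟨hs.1.le, hs.2.le⟩)
      (fun u hu => hY u (hsub hu)) (fun u hu => by
        rw [add_zero]
        exact ((A u).le_opNorm _).trans (mul_le_mul (hK u (Ioo_subset_Icc_self (hsub hu)))
          (hρn _) (norm_nonneg _) hK0.le))
    simpa [hY0] using this
  have h1 : χ (Y s) = 1 := χ.one_of_mem_closedBall (by
    rw [mem_closedBall_zero_iff]; change ‖Y s‖ ≤ R; linarith)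
  simpa [ρ, h1] using hY s hs

end Existence

/-! ### Differentiability in the initial value -/

section Dependence

theorem lipschitzWith_slice {E : Type*} [NormedAddCommGroup E] {w : ℝ × E → E} {K : ℝ≥0} (hw : LipschitzWith K w) (s : ℝ) :
    LipschitzWith K (fun x => w (s, x)) := by
  simpa [Function.comp_def] using hw.comp (LipschitzWith.prodMk_left s)

/-- A compactly supported `C¹` function is uniformly approximated by its differentials. -/
theorem exists_norm_sub_sub_fderiv_le {V F : Type*} [NormedAddCommGroup V] [NormedSpace ℝ V]
    [NormedAddCommGroup F] [NormedSpace ℝ F] {f : V → F} (hf : ContDiff ℝ 1 f)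
    (hc : HasCompactSupport f) {ε : ℝ} (hε : 0 < ε) :
    ∃ δ > 0, ∀ x y : V, ‖y - x‖ < δ → ‖f y - f x - fderiv ℝ f x (y - x)‖ ≤ ε * ‖y - x‖ := by
  have huc : UniformContinuous (fderiv ℝ f) :=
    (hc.fderiv ℝ).uniformContinuous_of_continuous (hf.continuous_fderiv one_ne_zero)
  obtain ⟨δ, hδ, h⟩ := Metric.uniformContinuous_iff.1 huc ε hε
  refine ⟨δ, hδ, fun x y hxy => ?_⟩
  refine (convex_ball x δ).norm_image_sub_le_of_norm_fderiv_le' (𝕜 := ℝ)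
    (fun z _ => (hf.differentiable one_ne_zero) z) (fun z hz => ?_) (Metric.mem_ball_self hδ)
    (by rwa [mem_ball_iff_norm])
  rw [← dist_eq_norm]
  exact (h hz).le

variable {E : Type*} [NormedAddCommGroup E] [NormedSpace ℝ E] [FiniteDimensional ℝ E]

/-- The differential of the flow of a compactly supported `C¹` vector field solves the linearized
equation. -/
theorem exists_flow_hasFDerivAt {w : ℝ × E → E} (hw : ContDiff ℝ 1 w) (hc : HasCompactSupport w)
    {T : ℝ} (hT : 0 < T) :
    ∃ Φ : E → ℝ → E, (∀ q, Φ q 0 = q) ∧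
      (∀ q, ∀ s ∈ Ioo (-T) T, HasDerivAt (Φ q) (w (s, Φ q s)) s) ∧
      ∀ q, ∃ A : ℝ → E →L[ℝ] E, A 0 = .id ℝ E ∧
        (∀ s ∈ Ioo (-T) T, HasDerivAt A
          (((fderiv ℝ w (s, Φ q s)).comp (.inr ℝ ℝ E)).comp (A s)) s) ∧
        ∀ s ∈ Ioo (-T) T, HasFDerivAt (fun p => Φ p s) (A s) q := by
  have : CompleteSpace E := FiniteDimensional.complete ℝ E
  obtain ⟨K', hK'⟩ := hw.lipschitzWith_of_hasCompactSupport hc one_ne_zero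
  set K : ℝ≥0 := K' + 1
  have hK : LipschitzWith K w := hK'.weaken (by simp [K])
  have hK0 : 0 < K := by positivity
  have hK0' : (0 : ℝ) < K := by exact_mod_cast hK0
  obtain ⟨L, hL⟩ := hc.exists_bound_of_continuous hw.continuous
  -- The margin `T + 1` makes the linearized coefficient `M` continuous on the closed interval `[-T,
  -- T]`.
  have hex : ∀ q, ∃ Q : ℝ → E, Q 0 = q ∧
      ∀ s ∈ Ioo (-(T + 1)) (T + 1), HasDerivAt Q (w (s, Q s)) s := fun q =>
    exists_solution_of_bounded (w := fun s x => w (s, x)) (K := K) (L := L.toNNReal)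
      (by linarith) (fun s _ => lipschitzWith_slice hK s)
      (fun x => (hw.continuous.comp (by fun_prop)).continuousOn)
      (fun s _ x => (hL _).trans (Real.le_coe_toNNReal L)) q
  choose Φ hΦ0 hΦ using hex
  have hTT : Icc (-T) T ⊆ Ioo (-(T + 1)) (T + 1) :=
    fun s hs => ⟨by linarith [hs.1], by linarith [hs.2]⟩
  have hΦT : ∀ q, ∀ s ∈ Ioo (-T) T, HasDerivAt (Φ q) (w (s, Φ q s)) s := fun q s hs =>
    hΦ q s (hTT (Ioo_subset_Icc_self hs))
  refine ⟨Φ, hΦ0, hΦT, fun q => ?_⟩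
  set M : ℝ → E →L[ℝ] E := fun s => (fderiv ℝ w (s, Φ q s)).comp (.inr ℝ ℝ E) with hM
  have hMc : ContinuousOn M (Icc (-T) T) := by
    have h1 : ContinuousOn (fun s => (s, Φ q s)) (Icc (-T) T) := continuousOn_id.prodMk
      fun s hs => (hΦ q s (hTT hs)).continuousAt.continuousWithinAt
    exact ((hw.continuous_fderiv one_ne_zero).comp_continuousOn h1).clm_comp continuousOn_const
  have hMn : ∀ s x, ‖M s x‖ ≤ K * ‖x‖ := fun s x => by
    have h1 := (fderiv ℝ w (s, Φ q s)).le_of_opNorm_le (norm_fderiv_le_of_lipschitz ℝ hK) (0, x)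
    simpa [hM, Prod.norm_def] using h1
  obtain ⟨A, hA0, hA⟩ := exists_solution_of_linear
    (A := fun s => ContinuousLinearMap.compL ℝ E E E (M s)) hT
    ((ContinuousLinearMap.compL ℝ E E E).continuous.comp_continuousOn hMc) (.id ℝ E)
  refine ⟨A, hA0, fun s hs => by simpa [hM] using hA s hs, fun t ht => ?_⟩
  have hsub := uIcc_zero_subset_Ioo ht
  have htT : |t - 0| ≤ T := by simpa [abs_le] using ⟨ht.1.le, ht.2.le⟩
  set X := Real.exp (K * T) with hX
  have hX0 : 0 < X := Real.exp_pos _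
  have hdist : ∀ p, ∀ s ∈ uIcc 0 t, ‖Φ p s - Φ q s‖ ≤ ‖p - q‖ * X := fun p s hs => by
    have hs' : uIcc 0 s ⊆ Ioo (-T) T := uIcc_zero_subset_Ioo (hsub hs)
    have hsT : |s - 0| ≤ T := by
      simpa [abs_le] using ⟨(hsub hs).1.le, (hsub hs).2.le⟩
    simpa [hΦ0] using norm_sub_le_of_solutions (w := fun s x => w (s, x)) hK0
      (lipschitzWith_slice hK) hsT (fun u hu => hΦT p u (hs' hu)) (fun u hu => hΦT q u (hs' hu))
  rw [hasFDerivAt_iff_isLittleO, Asymptotics.isLittleO_iff]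
  intro c hc0
  -- One factor `X` is lost in `hdist`, another factor `X / K` in the final Grönwall step; this
  -- choice leaves exactly `c`.
  obtain ⟨δ, hδ, hTay⟩ := exists_norm_sub_sub_fderiv_le hw hc (ε := c * K / (X * X)) (by positivity)
  filter_upwards [Metric.ball_mem_nhds q (div_pos hδ hX0)] with p hp
  rw [mem_ball_iff_norm, lt_div_iff₀ hX0] at hp
  set r : ℝ → E := fun s => w (s, Φ p s) - w (s, Φ q s) - M s (Φ p s - Φ q s)
  have hr : ∀ s ∈ uIcc 0 t, ‖r s‖ ≤ c * K / X * ‖p - q‖ := fun s hs => by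
    have h1 := hTay (s, Φ q s) (s, Φ p s)
    simp only [Prod.mk_sub_mk, sub_self, Prod.norm_mk, norm_zero, norm_nonneg, sup_of_le_right]
      at h1
    calc ‖r s‖ ≤ c * K / (X * X) * ‖Φ p s - Φ q s‖ := h1 ((hdist p s hs).trans_lt hp)
      _ ≤ c * K / (X * X) * (‖p - q‖ * X) := by gcongr; exact hdist p s hs
      _ = c * K / X * ‖p - q‖ := by field_simp
  -- The linearization error vanishes at time `0` and solves the linearized equation up to the
  -- Taylor remainder `r`.
  have hfin := norm_le_of_gronwall (f := fun s => Φ p s - Φ q s - A s (p - q))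
    (f' := fun s => w (s, Φ p s) - w (s, Φ q s) - M s (A s (p - q)))
    (ε := c * K / X * ‖p - q‖) hK0' (by positivity) htT
    (fun s hs => ((hΦT p s (hsub hs)).sub (hΦT q s (hsub hs))).sub <| by
      simpa using (hA s (hsub hs)).clm_apply (hasDerivAt_const s (p - q)))
    (fun s hs => by
      have e : w (s, Φ p s) - w (s, Φ q s) - M s (A s (p - q)) =
          M s (Φ p s - Φ q s - A s (p - q)) + r s := by
        simp only [r, map_sub]; abel
      rw [e]
      exact (norm_add_le _ _).trans (add_le_add (hMn _ _) (hr s hs)))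
  refine hfin.trans (le_of_eq ?_)
  simp only [hΦ0, hA0, ContinuousLinearMap.id_apply, sub_self, norm_zero, zero_add]
  rw [← hX]
  field_simp

end Dependence

/-! ### Liouville's formula -/

/-- Jacobi's formula along a curve of matrices with `N' = M N`. -/
theorem hasDerivAt_det {n : Type*} [Fintype n] [DecidableEq n] {N : ℝ → Matrix n n ℝ}
    {M : Matrix n n ℝ} {s : ℝ} (h : ∀ i j, HasDerivAt (fun u => N u i j) ((M * N s) i j) s) :
    HasDerivAt (fun u => (N u).det) (M.trace * (N s).det) s := by
  let D : ContinuousMultilinearMap ℝ (fun _ : n => n → ℝ) ℝ :=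
    { (Matrix.detRowAlternating (n := n) (R := ℝ)).toMultilinearMap with
      cont := Continuous.matrix_det (R := ℝ) (A := fun x : Matrix n n ℝ => x) continuous_id }
  have hN : HasDerivAt (fun u i j => N u i j) (fun i j => (M * N s) i j) s :=
    hasDerivAt_pi.2 fun i => hasDerivAt_pi.2 fun j => h i j
  have hD := (D.hasFDerivAt (fun i j => N s i j)).comp_hasDerivAt s hN
  have hval : D.linearDeriv (fun i j => N s i j) (fun i j => (M * N s) i j) =
      M.trace * (N s).det := by
    rw [ContinuousMultilinearMap.linearDeriv_apply, Matrix.trace, Finset.sum_mul]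
    refine Finset.sum_congr rfl fun i _ => ?_
    set R : n → n → ℝ := fun i j => N s i j with hR
    -- Row `i` of `M * N` combines the rows of `N`; in the determinant all terms but `k = i` have
    -- two equal rows.
    have hrow : (fun j => (M * N s) i j) = ∑ k, M i k • R k := by
      ext j; simp [Matrix.mul_apply, hR]
    rw [hrow]
    change D.toMultilinearMap (Function.update R i (∑ k, M i k • R k)) = _
    rw [MultilinearMap.map_update_sum, Finset.sum_eq_single i]
    · rw [MultilinearMap.map_update_smul, smul_eq_mul, Function.update_eq_self]
      rfl
    · intro k _ hk
      rw [MultilinearMap.map_update_smul]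
      have : D.toMultilinearMap (Function.update R i (R k)) = 0 :=
        Matrix.det_zero_of_row_eq (M := Function.update R i (R k)) hk.symm (by
          simp [Function.update_of_ne hk])
      rw [this, smul_zero]
    · simp
  rw [hval] at hD
  exact hD

/-- Liouville's formula: the determinant of a solution of a linear equation. -/
theorem hasDerivAt_det_clm {d : ℕ} {A : ℝ → Space d →L[ℝ] Space d} {M : Space d →L[ℝ] Space d}
    {s : ℝ} (h : HasDerivAt A (M.comp (A s)) s) :
    HasDerivAt (fun u => (A u).det)
      ((∑ i, M (EuclideanSpace.single i 1) i) * (A s).det) s := by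
  let b := (EuclideanSpace.basisFun (Fin d) ℝ).toBasis
  let m : (Space d →L[ℝ] Space d) → Matrix (Fin d) (Fin d) ℝ := fun B =>
    LinearMap.toMatrix b b (B : Space d →ₗ[ℝ] Space d)
  have hm : ∀ B i j, m B i j = B (EuclideanSpace.single j 1) i := fun B i j => by
    simp [m, b, LinearMap.toMatrix_apply]
  have hdet : ∀ B : Space d →L[ℝ] Space d, B.det = (m B).det := fun B =>
    (LinearMap.det_toMatrix b _).symm
  have htr : ∑ i, M (EuclideanSpace.single i 1) i = (m M).trace := by
    simp [Matrix.trace, hm]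
  have hmul : m (M.comp (A s)) = m M * m (A s) := LinearMap.toMatrix_comp b b b _ _
  simp_rw [hdet, htr]
  refine hasDerivAt_det fun i j => ?_
  rw [← hmul]
  simp_rw [hm]
  have h1 : HasDerivAt (fun u => A u (EuclideanSpace.single j 1))
      (M.comp (A s) (EuclideanSpace.single j 1)) s := by
    simpa using h.clm_apply (hasDerivAt_const s (EuclideanSpace.single j (1 : ℝ)))
  exact ((EuclideanSpace.proj i : Space d →L[ℝ] ℝ).hasFDerivAt).comp_hasDerivAt s h1

/-! ### Cutoff, velocity field and continuity equation -/

/-- A `C¹` vector field on an open set agrees near a compact subset with a compactly supported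
`C¹` vector field. -/
theorem exists_contDiff_hasCompactSupport_eventuallyEq {V F : Type*} [NormedAddCommGroup V]
    [NormedSpace ℝ V] [FiniteDimensional ℝ V] [NormedAddCommGroup F] [NormedSpace ℝ F]
    {v : V → F} {G K : Set V} (hG : IsOpen G) (hv : ContDiffOn ℝ 1 v G) (hK : IsCompact K)
    (hKG : K ⊆ G) :
    ∃ w : V → F, ContDiff ℝ 1 w ∧ HasCompactSupport w ∧ ∀ᶠ x in 𝓝ˢ K, w x = v x := by
  obtain ⟨L, hL, hKL, hLG⟩ := exists_compact_between hK hG hKG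
  obtain ⟨χ, hχ1, hχ0, -⟩ := exists_contMDiffMap_one_nhds_of_subset_interior (n := 1)
    (modelWithCornersSelf ℝ V) hK.isClosed hKL
  have hχ : ContDiff ℝ 1 χ := χ.contMDiff.contDiff
  refine ⟨fun x => χ x • v x, contDiff_iff_contDiffAt.2 fun x => ?_,
    HasCompactSupport.intro hL fun x hx => by simp [hχ0 x hx], ?_⟩
  · by_cases hx : x ∈ G
    · exact hχ.contDiffAt.smul (hv.contDiffAt (hG.mem_nhds hx))
    · have : (fun x => χ x • v x) =ᶠ[𝓝 x] fun _ => 0 := by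
        filter_upwards [hL.isClosed.isOpen_compl.mem_nhds fun h => hx (hLG h)] with y hy
        simp [hχ0 y hy]
      exact contDiffAt_const.congr_of_eventuallyEq this
  · filter_upwards [hχ1] with x hx
    simp [hx]

variable {d : ℕ} {C : Set (Space d)} {j : ℝ × Space d → ℝ × Space d}

/-- The velocity field `J / j⁰`. -/
def velocity (j : ℝ × Space d → ℝ × Space d) (x : ℝ × Space d) : Space d := (j x).1⁻¹ • (j x).2

/-- The points of `ℝ × C` that are not nodes. -/
def nonNodes (C : Set (Space d)) (j : ℝ × Space d → ℝ × Space d) : Set (ℝ × Space d) :=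
  (univ ×ˢ C) ∩ j ⁻¹' {0}ᶜ

theorem IsConfigurationSpace.isOpen (hC : IsConfigurationSpace C) : IsOpen C := by
  rcases hC with rfl | ⟨m, S, hS, rfl⟩
  · exact isOpen_univ
  · exact isOpen_univ.sdiff (isClosed_iUnion_of_finite fun l => (hS l).1)

theorem IsCurrent.isOpen_nonNodes (hj : IsCurrent C j) (hC : IsOpen C) : IsOpen (nonNodes C j) :=
  hj.contDiffOn.continuousOn.isOpen_inter_preimage (isOpen_univ.prod hC) isOpen_compl_singleton

theorem IsCurrent.pos_of_mem (hj : IsCurrent C j) {x : ℝ × Space d} (hx : x ∈ nonNodes C j) :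
    0 < (j x).1 :=
  hj.pos x.1 x.2 hx.1.2 hx.2

theorem IsCurrent.contDiffOn_velocity (hj : IsCurrent C j) :
    ContDiffOn ℝ 1 (velocity j) (nonNodes C j) := by
  have h := hj.contDiffOn.mono (inter_subset_left (t := j ⁻¹' {0}ᶜ))
  exact (h.fst.inv fun x hx => (hj.pos_of_mem hx).ne').smul h.snd

theorem IsCurrent.hasFDerivAt (hj : IsCurrent C j) (hC : IsOpen C) {x : ℝ × Space d}
    (hx : x ∈ nonNodes C j) : HasFDerivAt j (fderiv ℝ j x) x :=
  ((hj.contDiffOn.contDiffAt ((isOpen_univ.prod hC).mem_nhds hx.1)).differentiableAt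
    one_ne_zero).hasFDerivAt

/-- The continuity equation in terms of the density and the velocity field. -/
theorem IsCurrent.continuity_equation (hj : IsCurrent C j) (hC : IsOpen C)
    {w : ℝ × Space d → Space d} {x : ℝ × Space d} (hx : x ∈ nonNodes C j)
    (hw : DifferentiableAt ℝ w x) (hwv : ∀ᶠ y in 𝓝 x, w y = velocity j y) :
    (fderiv ℝ j x (1, w x)).1 +
      (∑ i, fderiv ℝ w x (0, EuclideanSpace.single i 1) i) * (j x).1 = 0 := by
  have hD := hj.hasFDerivAt hC hx
  set D := fderiv ℝ j x
  have h1 : HasFDerivAt (fun y => (j y).2) _ x := hD.snd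
  have h2 : HasFDerivAt (fun y => (j y).1 • w y) _ x := hD.fst.smul hw.hasFDerivAt
  -- Differentiating $J=j^0w$ near `x` expresses the spatial derivatives of $J$ through those of
  -- $j^0$ and `w`.
  have heq : (fun y => (j y).2) =ᶠ[𝓝 x] fun y => (j y).1 • w y := by
    filter_upwards [hwv, (hj.isOpen_nonNodes hC).mem_nhds hx] with y hy hy'
    rw [hy, velocity, smul_inv_smul₀ (hj.pos_of_mem hy').ne']
  have h3 := h1.unique (h2.congr_of_eventuallyEq heq)
  have h4 : ∀ i, (D (0, EuclideanSpace.single i 1)).2 i =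
      (j x).1 * fderiv ℝ w x (0, EuclideanSpace.single i 1) i +
        (D (0, EuclideanSpace.single i 1)).1 * w x i := fun i => by
    simpa using congrArg (fun f => f (0, EuclideanSpace.single i (1 : ℝ)) i) h3
  have hdiv := hj.divergence_eq_zero x.1 x.2 hx.1.2
  rw [divergence] at hdiv
  change (D (1, 0)).1 + ∑ i, (D (0, EuclideanSpace.single i 1)).2 i = 0 at hdiv
  have hsum : ((0 : ℝ), w x) = ∑ i, w x i • ((0 : ℝ), EuclideanSpace.single i (1 : ℝ)) := by
    refine Prod.ext (by simp [Prod.fst_sum]) ?_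
    simp only [Prod.snd_sum, Prod.smul_snd]
    simpa using ((EuclideanSpace.basisFun (Fin d) ℝ).sum_repr (w x)).symm
  have hone : ((1 : ℝ), w x) = (1, 0) + (0, w x) := by simp
  rw [hone, map_add, hsum, map_sum, Prod.fst_add, Prod.fst_sum]
  simp_rw [h4, Finset.sum_add_distrib, ← Finset.mul_sum] at hdiv
  have h5 : ∑ i, (D (w x i • ((0 : ℝ), EuclideanSpace.single i (1 : ℝ)))).1 =
      ∑ i, (D (0, EuclideanSpace.single i 1)).1 * w x i :=
    Finset.sum_congr rfl fun i _ => by rw [map_smul, Prod.smul_fst, smul_eq_mul, mul_comm]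
  rw [h5]
  linarith

/-! ### Uniqueness and the local flow -/

section Solutions

variable {q q₁ q₂ : Space d} {a b a₁ b₁ a₂ b₂ t : ℝ} {Q Q₁ Q₂ : ℝ → Space d}

theorem IsSolution.graph_mem (h : IsSolution C j q a b Q) {s : ℝ} (hs : s ∈ Ioo a b) :
    (s, Q s) ∈ nonNodes C j :=
  ⟨⟨mem_univ _, h.mem s hs⟩, h.ne_node s hs⟩

theorem IsSolution.hasDerivAt_velocity (h : IsSolution C j q a b Q) {s : ℝ} (hs : s ∈ Ioo a b) :
    HasDerivAt Q (velocity j (s, Q s)) s :=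
  h.hasDerivAt s hs

theorem IsSolution.continuousOn_graph (h : IsSolution C j q a b Q) :
    ContinuousOn (fun s => (s, Q s)) (Ioo a b) :=
  continuousOn_id.prodMk fun s hs => (h.hasDerivAt s hs).continuousAt.continuousWithinAt

/-- Solutions that meet at some time agree at all common times. -/
theorem IsSolution.eq_of_eq (hj : IsCurrent C j) (hC : IsOpen C)
    (h₁ : IsSolution C j q₁ a₁ b₁ Q₁) (h₂ : IsSolution C j q₂ a₂ b₂ Q₂) {r s : ℝ}
    (hr₁ : r ∈ Ioo a₁ b₁) (hr₂ : r ∈ Ioo a₂ b₂) (hs₁ : s ∈ Ioo a₁ b₁) (hs₂ : s ∈ Ioo a₂ b₂)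
    (h : Q₁ r = Q₂ r) : Q₁ s = Q₂ s := by
  have hI₁ : uIcc r s ⊆ Ioo a₁ b₁ := ordConnected_Ioo.uIcc_subset hr₁ hs₁
  have hI₂ : uIcc r s ⊆ Ioo a₂ b₂ := ordConnected_Ioo.uIcc_subset hr₂ hs₂
  -- The cutoff field near both graphs is globally Lipschitz, and both curves solve its equation.
  set K : Set (ℝ × Space d) :=
    (fun u => (u, Q₁ u)) '' uIcc r s ∪ (fun u => (u, Q₂ u)) '' uIcc r s
  have hK : IsCompact K :=
    (isCompact_uIcc.image_of_continuousOn (h₁.continuousOn_graph.mono hI₁)).union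
      (isCompact_uIcc.image_of_continuousOn (h₂.continuousOn_graph.mono hI₂))
  have hKG : K ⊆ nonNodes C j := by
    rintro _ (⟨u, hu, rfl⟩ | ⟨u, hu, rfl⟩)
    exacts [h₁.graph_mem (hI₁ hu), h₂.graph_mem (hI₂ hu)]
  obtain ⟨w, hw, hwc, hwv⟩ := exists_contDiff_hasCompactSupport_eventuallyEq
    (hj.isOpen_nonNodes hC) hj.contDiffOn_velocity hK hKG
  have hwK := hwv.self_of_nhdsSet
  obtain ⟨k, hk⟩ := hw.lipschitzWith_of_hasCompactSupport hwc one_ne_zero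
  have := norm_sub_le_of_solutions (w := fun u x => w (u, x)) (K := k + 1) (by positivity)
    (fun u => (lipschitzWith_slice hk u).weaken (by simp)) (f := Q₁) (g := Q₂) (a := r) (b := s)
    le_rfl
    (fun u hu => by
      simpa [hwK _ (Or.inl (mem_image_of_mem _ hu))] using h₁.hasDerivAt_velocity (hI₁ hu))
    (fun u hu => by
      simpa [hwK _ (Or.inr (mem_image_of_mem _ hu))] using h₂.hasDerivAt_velocity (hI₂ hu))
  rw [h, sub_self, norm_zero, zero_mul] at this
  exact sub_eq_zero.1 (norm_le_zero_iff.1 this)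

/-- Near the initial point of a solution the flow is defined and differentiable, and its Jacobian
determinant is the quotient of the densities. -/
theorem IsSolution.exists_local_flow (hj : IsCurrent C j) (hC : IsOpen C)
    (h : IsSolution C j q a b Q) (ht : t ∈ Ioo a b) :
    ∃ (Φ : Space d → Space d) (A : Space d →L[ℝ] Space d), HasFDerivAt Φ A q ∧
      A.det * (j (t, Q t)).1 = (j (0, q)).1 ∧
      ∀ᶠ p in 𝓝 q, ∃ (a' b' : ℝ) (Q' : ℝ → Space d),
        IsSolution C j p a' b' Q' ∧ t ∈ Ioo a' b' ∧ Q' t = Φ p := by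
  -- Shrinking to a compact `[a', b']` with `0` and `t` inside makes the graph `K` compact.
  obtain ⟨a', ha', ha't⟩ := exists_between (lt_min h.zero_mem.1 ht.1)
  obtain ⟨b', hb't, hb'⟩ := exists_between (max_lt h.zero_mem.2 ht.2)
  rw [lt_min_iff] at ha't
  rw [max_lt_iff] at hb't
  have h0' : (0 : ℝ) ∈ Ioo a' b' := ⟨ha't.1, hb't.1⟩
  have ht' : t ∈ Ioo a' b' := ⟨ha't.2, hb't.2⟩
  have hI : Icc a' b' ⊆ Ioo a b := Icc_subset_Ioo ha' hb'
  have hseg : ∀ s ∈ Icc a' b', uIcc 0 s ⊆ Icc a' b' := fun s hs =>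
    ordConnected_Icc.uIcc_subset (Ioo_subset_Icc_self h0') hs
  set T : ℝ := b' - a' with hTdef
  have hT : 0 < T := by linarith [h0'.1, h0'.2]
  have hIT : Icc a' b' ⊆ Ioo (-T) T := fun s hs =>
    ⟨by linarith [hs.1, h0'.1, h0'.2], by linarith [hs.2, h0'.1, h0'.2]⟩
  have habs : ∀ s ∈ Icc a' b', |s - 0| ≤ T := fun s hs => by
    simpa [abs_le] using ⟨(hIT hs).1.le, (hIT hs).2.le⟩
  set K : Set (ℝ × Space d) := (fun s => (s, Q s)) '' Icc a' b'
  have hK : IsCompact K := isCompact_Icc.image_of_continuousOn (h.continuousOn_graph.mono hI)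
  have hKG : K ⊆ nonNodes C j := by
    rintro _ ⟨u, hu, rfl⟩
    exact h.graph_mem (hI hu)
  have hG := hj.isOpen_nonNodes hC
  obtain ⟨w, hw, hwc, hwv⟩ := exists_contDiff_hasCompactSupport_eventuallyEq
    hG hj.contDiffOn_velocity hK hKG
  -- In this tube `w` is the velocity and there are no nodes, so solutions for `w` staying there are
  -- trajectories.
  obtain ⟨δ, hδ, hδw⟩ := (Metric.hasBasis_nhdsSet_thickening hK).eventually_iff.1
    (hwv.and (hG.mem_nhdsSet.2 hKG))
  obtain ⟨k', hk'⟩ := hw.lipschitzWith_of_hasCompactSupport hwc one_ne_zero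
  obtain ⟨k, hk0, hk⟩ : ∃ k : ℝ≥0, 0 < k ∧ LipschitzWith k w :=
    ⟨k' + 1, by positivity, hk'.weaken (by simp)⟩
  obtain ⟨Φ, hΦ0, hΦ, hΦA⟩ := exists_flow_hasFDerivAt hw hwc hT
  have hΦq : ∀ s ∈ Icc a' b', Φ q s = Q s := fun s hs => by
    have := norm_sub_le_of_solutions (w := fun u x => w (u, x)) hk0 (lipschitzWith_slice hk)
      (f := Φ q) (g := Q) (habs s hs) (fun u hu => hΦ q u (hIT (hseg s hs hu))) (fun u hu => by
        have hu' := hseg s hs hu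
        simpa [hwv.self_of_nhdsSet _ (mem_image_of_mem _ hu')] using
          h.hasDerivAt_velocity (hI hu'))
    rw [hΦ0, h.initial, sub_self, norm_zero, zero_mul] at this
    exact sub_eq_zero.1 (norm_le_zero_iff.1 this)
  obtain ⟨A, hA0, hA, hAd⟩ := hΦA q
  refine ⟨fun p => Φ p t, A t, hAd t (hIT (Ioo_subset_Icc_self ht')), ?_, ?_⟩
  · have hderiv : ∀ s ∈ Icc a' b',
        HasDerivAt (fun u => (A u).det * (j (u, Q u)).1 - (j (0, q)).1) 0 s := fun s hs => by
      have hx : (s, Q s) ∈ nonNodes C j := h.graph_mem (hI hs)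
      have hev : ∀ᶠ y in 𝓝 (s, Q s), w y = velocity j y :=
        (eventually_nhdsSet_iff_forall.1 hwv) _ (mem_image_of_mem _ hs)
      have hce := hj.continuity_equation hC hx ((hw.differentiable one_ne_zero) _) hev
      have hA' := hasDerivAt_det_clm (hA s (hIT hs))
      rw [hΦq s hs] at hA'
      have hQ' : HasDerivAt (fun u => (u, Q u)) ((1 : ℝ), w (s, Q s)) s := by
        rw [hev.self_of_nhds]
        exact (hasDerivAt_id s).prodMk (h.hasDerivAt_velocity (hI hs))
      have hj' : HasDerivAt (fun u => (j (u, Q u)).1)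
          (fderiv ℝ j (s, Q s) (1, w (s, Q s))).1 s :=
        HasFDerivAt.comp_hasDerivAt (f := fun u => (u, Q u)) s (hj.hasFDerivAt hC hx).fst hQ'
      simp only [ContinuousLinearMap.comp_apply, ContinuousLinearMap.inr_apply] at hA'
      refine ((hA'.mul hj').sub_const (j (0, q)).1).congr_deriv ?_
      linear_combination (A s).det * hce
    -- A function with zero derivative that vanishes at time `0`, where `A 0 = id`, vanishes at `t`.
    have := norm_le_of_gronwall (f' := fun _ => (0 : ℝ)) one_pos le_rfl
      (habs t (Ioo_subset_Icc_self ht'))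
      (fun s hs => hderiv s (hseg t (Ioo_subset_Icc_self ht') hs)) (by simp)
    simp only [hA0, h.initial, ContinuousLinearMap.det, ContinuousLinearMap.coe_id,
      LinearMap.det_id, one_mul, sub_self, norm_zero, zero_div, add_zero, zero_mul] at this
    exact sub_eq_zero.1 (norm_le_zero_iff.1 this)
  · set X := Real.exp (k * T)
    have hX : 0 < X := Real.exp_pos _
    -- Separation grows by at most the factor `X`, so radius `δ / X` keeps the trajectory in the
    -- tube.
    filter_upwards [Metric.ball_mem_nhds q (div_pos hδ hX)] with p hp
    rw [mem_ball_iff_norm, lt_div_iff₀ hX] at hp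
    have htube : ∀ s ∈ Ioo a' b', (s, Φ p s) ∈ Metric.thickening δ K := fun s hs => by
      have hs' := Ioo_subset_Icc_self hs
      refine Metric.mem_thickening_iff.2 ⟨(s, Q s), mem_image_of_mem _ hs', ?_⟩
      have := norm_sub_le_of_solutions (w := fun u x => w (u, x)) hk0 (lipschitzWith_slice hk)
        (f := Φ p) (g := Φ q) (habs s hs') (fun u hu => hΦ p u (hIT (hseg s hs' hu)))
        (fun u hu => hΦ q u (hIT (hseg s hs' hu)))
      rw [hΦ0, hΦ0, hΦq s hs'] at this
      simpa [Prod.dist_eq, dist_eq_norm] using this.trans_lt hp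
    refine ⟨a', b', Φ p, ⟨h0', hΦ0 p, fun s hs => (hδw (htube s hs)).2.1.2,
      fun s hs => (hδw (htube s hs)).2.2, fun s hs => ?_⟩, ht', rfl⟩
    have := hΦ p s (hIT (Ioo_subset_Icc_self hs))
    rwa [(hδw (htube s hs)).1] at this

end Solutions

/-! ### The time-`t` map on its open domain -/

variable {t : ℝ}

/-- The configurations whose trajectory exists up to time `t`. -/
def flowDomain (C : Set (Space d)) (j : ℝ × Space d → ℝ × Space d) (t : ℝ) : Set (Space d) :=
  {q | ∃ (a b : ℝ) (Q : ℝ → Space d), IsSolution C j q a b Q ∧ t ∈ Ioo a b}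

open Classical in
/-- The configuration at time `t` on the trajectory starting in `q`, if it exists. -/
def position (C : Set (Space d)) (j : ℝ × Space d → ℝ × Space d) (t : ℝ) (q : Space d) : Space d :=
  if h : ∃ (a b : ℝ) (Q : ℝ → Space d), IsSolution C j q a b Q ∧ t ∈ Ioo a b then
    h.choose_spec.choose_spec.choose t
  else q

theorem position_eq (hj : IsCurrent C j) (hC : IsOpen C) {q : Space d} {a b : ℝ}
    {Q : ℝ → Space d} (h : IsSolution C j q a b Q) (ht : t ∈ Ioo a b) :
    position C j t q = Q t := by
  have hex : ∃ (a b : ℝ) (Q : ℝ → Space d), IsSolution C j q a b Q ∧ t ∈ Ioo a b :=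
    ⟨a, b, Q, h, ht⟩
  rw [position, dif_pos hex]
  have hs := hex.choose_spec.choose_spec.choose_spec
  exact hs.1.eq_of_eq hj hC h hs.1.zero_mem h.zero_mem hs.2 ht (hs.1.initial.trans h.initial.symm)

theorem position_mem (hj : IsCurrent C j) (hC : IsOpen C) {q : Space d}
    (hq : q ∈ flowDomain C j t) : position C j t q ∈ C := by
  obtain ⟨a, b, Q, h, ht⟩ := hq
  rw [position_eq hj hC h ht]
  exact h.mem t ht

theorem flowDomain_subset : flowDomain C j t ⊆ C := by
  rintro q ⟨a, b, Q, h, -⟩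
  exact h.initial ▸ h.mem 0 h.zero_mem

theorem isOpen_flowDomain (hj : IsCurrent C j) (hC : IsOpen C) : IsOpen (flowDomain C j t) := by
  refine isOpen_iff_mem_nhds.2 ?_
  rintro q ⟨a, b, Q, h, ht⟩
  obtain ⟨Φ, A, -, -, hΦ⟩ := h.exists_local_flow hj hC ht
  filter_upwards [hΦ] with p ⟨a', b', Q', h', ht', _⟩
  exact ⟨a', b', Q', h', ht'⟩

/-- Near `q` the map is the local flow; positivity of both densities forces a positive determinant,
so the absolute value needed for change of variables is harmless. -/
theorem exists_hasFDerivAt_position (hj : IsCurrent C j) (hC : IsOpen C) {q : Space d}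
    (hq : q ∈ flowDomain C j t) :
    ∃ A : Space d →L[ℝ] Space d, HasFDerivAt (position C j t) A q ∧
      |A.det| * (j (t, position C j t q)).1 = (j (0, q)).1 := by
  obtain ⟨a, b, Q, h, ht⟩ := hq
  obtain ⟨Φ, A, hA, hdet, hΦ⟩ := h.exists_local_flow hj hC ht
  refine ⟨A, hA.congr_of_eventuallyEq ?_, ?_⟩
  · filter_upwards [hΦ] with p ⟨a', b', Q', h', ht', hp⟩
    rw [position_eq hj hC h' ht', hp]
  · rw [position_eq hj hC h ht]
    have h0 : 0 < (j (0, q)).1 := by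
      simpa [h.initial] using hj.pos_of_mem (h.graph_mem h.zero_mem)
    have h1 := hj.pos_of_mem (h.graph_mem ht)
    rw [← hdet] at h0
    rw [abs_of_pos (pos_of_mul_pos_left h0 h1.le), hdet]

/-- Uniqueness is applied backwards, from time `t` to time `0`. -/
theorem injOn_position (hj : IsCurrent C j) (hC : IsOpen C) :
    InjOn (position C j t) (flowDomain C j t) := by
  rintro q₁ ⟨a₁, b₁, Q₁, h₁, ht₁⟩ q₂ ⟨a₂, b₂, Q₂, h₂, ht₂⟩ h
  rw [position_eq hj hC h₁ ht₁, position_eq hj hC h₂ ht₂] at h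
  rw [← h₁.initial, ← h₂.initial]
  exact h₁.eq_of_eq hj hC h₂ ht₁ ht₂ h₁.zero_mem h₂.zero_mem h

theorem continuousOn_position (hj : IsCurrent C j) (hC : IsOpen C) :
    ContinuousOn (position C j t) (flowDomain C j t) := fun _ hq =>
  let ⟨_, hA, _⟩ := exists_hasFDerivAt_position hj hC hq
  hA.continuousAt.continuousWithinAt

theorem flow_of_mem (hj : IsCurrent C j) (hC : IsOpen C) {q : C}
    (hq : (q : Space d) ∈ flowDomain C j t) :
    flow C j t q = some ⟨position C j t q, position_mem hj hC hq⟩ := by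
  obtain ⟨a, b, Q, h, ht⟩ := id hq
  have hex : ∃ p : C, ∃ (a b : ℝ) (Q : ℝ → Space d),
      IsSolution C j q a b Q ∧ t ∈ Ioo a b ∧ Q t = p :=
    ⟨⟨Q t, h.mem t ht⟩, a, b, Q, h, ht, rfl⟩
  rw [flow, dif_pos hex]
  obtain ⟨a', b', Q', h', ht', hp⟩ := hex.choose_spec
  exact congrArg some (Subtype.ext (hp.symm.trans (position_eq hj hC h' ht').symm))

theorem flow_of_notMem {q : C} (hq : (q : Space d) ∉ flowDomain C j t) :
    flow C j t q = if t = 0 then some q else none := by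
  rw [flow, dif_neg]
  rintro ⟨p, a, b, Q, h, ht, -⟩
  exact hq ⟨a, b, Q, h, ht⟩

theorem flow_zero (hj : IsCurrent C j) (hC : IsOpen C) : flow C j 0 = some := by
  ext1 q
  by_cases hq : (q : Space d) ∈ flowDomain C j 0
  · rw [flow_of_mem hj hC hq]
    obtain ⟨a, b, Q, h, ht⟩ := hq
    exact congrArg some (Subtype.ext ((position_eq hj hC h ht).trans h.initial))
  · rw [flow_of_notMem hq, if_pos rfl]

/-- At `t = 0` this fails for nodes, which the flow fixes although they lie outside `flowDomain`;
hence the separate case `t = 0` below. -/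
theorem flow_eq_some_iff (hj : IsCurrent C j) (hC : IsOpen C) (ht : t ≠ 0) {q p : C} :
    flow C j t q = some p ↔ (q : Space d) ∈ flowDomain C j t ∧ position C j t q = p := by
  by_cases hq : (q : Space d) ∈ flowDomain C j t
  · rw [flow_of_mem hj hC hq]
    simp [hq, Subtype.ext_iff]
  · simp [flow_of_notMem hq, ht, hq]

theorem preimage_flow_image_some (hj : IsCurrent C j) (hC : IsOpen C) (ht : t ≠ 0) (B : Set C) :
    flow C j t ⁻¹' (some '' B) =
      Subtype.val ⁻¹' (flowDomain C j t ∩ position C j t ⁻¹' (Subtype.val '' B)) := by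
  ext q
  constructor
  · rintro ⟨p, hp, hpq⟩
    obtain ⟨h1, h2⟩ := (flow_eq_some_iff hj hC ht).1 hpq.symm
    exact ⟨h1, p, hp, h2.symm⟩
  · rintro ⟨h1, p, hp, h2⟩
    exact ⟨p, hp, ((flow_eq_some_iff hj hC ht).2 ⟨h1, h2.symm⟩).symm⟩

theorem val_image_inter_flowImage (hj : IsCurrent C j) (hC : IsOpen C) (ht : t ≠ 0) (B : Set C) :
    Subtype.val '' (B ∩ flowImage C j t) =
      position C j t '' (flowDomain C j t ∩ position C j t ⁻¹' (Subtype.val '' B)) := by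
  ext x
  constructor
  · rintro ⟨p, ⟨hp, q, hq⟩, rfl⟩
    obtain ⟨h1, h2⟩ := (flow_eq_some_iff hj hC ht).1 hq
    exact ⟨q, ⟨h1, p, hp, h2.symm⟩, h2⟩
  · rintro ⟨q, ⟨h1, p, hp, h2⟩, rfl⟩
    exact ⟨p, ⟨hp, ⟨q, flowDomain_subset h1⟩, (flow_eq_some_iff hj hC ht).2 ⟨h1, h2.symm⟩⟩, h2⟩

/-! ### Measurability -/

theorem measurableSet_inter_position_preimage (hj : IsCurrent C j) (hC : IsOpen C)
    {B : Set (Space d)} (hB : MeasurableSet B) :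
    MeasurableSet (flowDomain C j t ∩ position C j t ⁻¹' B) := by
  have hU := (isOpen_flowDomain (t := t) hj hC).measurableSet
  have := (continuousOn_position (t := t) hj hC).domRestrict.measurable hB
  have := hU.subtype_image this
  convert this using 1
  ext x
  simp [and_comm]

theorem measurableSet_image_some {B : Set C} (hB : MeasurableSet B) :
    MeasurableSet (some '' B : Set (WithCemetery C)) := by
  change MeasurableSet (some ⁻¹' (some '' B))
  rwa [preimage_image_eq _ (Option.some_injective _)]

theorem measurable_flow (hj : IsCurrent C j) (hC : IsOpen C) : Measurable (flow C j t) := by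
  rcases eq_or_ne t 0 with rfl | ht
  · rw [flow_zero hj hC]
    exact fun s hs => hs
  have hsome : ∀ B : Set C, MeasurableSet B → MeasurableSet (flow C j t ⁻¹' (some '' B)) :=
    fun B hB => by
      rw [preimage_flow_image_some hj hC ht]
      exact (measurableSet_inter_position_preimage hj hC
        (hC.measurableSet.subtype_image hB)).preimage measurable_subtype_coe
  -- The fibre over the cemetery is the complement of the preimage of `C`.
  have hnone : MeasurableSet (flow C j t ⁻¹' {none}) := by
    convert (hsome univ .univ).compl using 1
    ext q
    cases h : flow C j t q <;> simp [h]
  intro s hs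
  have hs' : MeasurableSet (some ⁻¹' s : Set C) := hs
  have hsplit : s = some '' (some ⁻¹' s : Set C) ∪ s ∩ {none} := by
    ext x
    cases x <;> simp
  rw [hsplit, preimage_union]
  refine (hsome _ hs').union ?_
  by_cases h : none ∈ s
  · rwa [inter_eq_self_of_subset_right (singleton_subset_iff.2 h)]
  · simp [inter_singleton_eq_empty.2 h]

/-- Lusin–Souslin: an injective continuous image of a Borel set is Borel. -/
theorem measurableSet_flowImage (hj : IsCurrent C j) (hC : IsOpen C) :
    MeasurableSet (flowImage C j t) := by
  rcases eq_or_ne t 0 with rfl | ht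
  · simp only [flowImage, flow_zero hj hC]
    convert MeasurableSet.univ
    ext x
    simp
  have h1 : MeasurableSet (Subtype.val '' (univ ∩ flowImage C j t)) := by
    rw [val_image_inter_flowImage hj hC ht]
    exact (measurableSet_inter_position_preimage hj hC
      (hC.measurableSet.subtype_image .univ)).image_of_continuousOn_injOn
      ((continuousOn_position hj hC).mono inter_subset_left)
      ((injOn_position hj hC).mono inter_subset_left)
  rw [univ_inter] at h1
  have := h1.preimage (measurable_subtype_coe (p := (· ∈ C)))
  rwa [preimage_image_eq _ Subtype.val_injective] at this

/-! ### Transport of the measures -/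

/-- Moves the integral from the subtype to `Space d`, where the change of variables takes place. -/
theorem densityMeasure_apply (hC : IsOpen C) {B : Set C} (hB : MeasurableSet B) :
    densityMeasure C j t B = ∫⁻ q in Subtype.val '' B, ENNReal.ofReal (j (t, q)).1 := by
  have he : MeasurableEmbedding (Subtype.val : C → Space d) :=
    MeasurableEmbedding.subtype_coe hC.measurableSet
  rw [densityMeasure, withDensity_apply _ hB, ← he.lintegral_map (μ := (volume.comap _).restrict B)
    (fun q => ENNReal.ofReal (j (t, q)).1), ← preimage_image_eq B Subtype.val_injective,
    ← he.restrict_map, he.map_comap, preimage_image_eq B Subtype.val_injective,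
    Measure.restrict_restrict (he.measurableSet_image.2 hB), Subtype.range_coe,
    inter_eq_self_of_subset_left (Subtype.coe_image_subset C B)]

/-- The change of variables formula for the flow. -/
theorem lintegral_position_image (hj : IsCurrent C j) (hC : IsOpen C) {S : Set (Space d)}
    (hS : MeasurableSet S) (hSU : S ⊆ flowDomain C j t) :
    ∫⁻ p in position C j t '' S, ENNReal.ofReal (j (t, p)).1 =
      ∫⁻ q in S, ENNReal.ofReal (j (0, q)).1 := by
  choose! A hA hdet using fun q (hq : q ∈ flowDomain C j t) =>
    exists_hasFDerivAt_position hj hC hq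
  rw [lintegral_image_eq_lintegral_abs_det_fderiv_mul volume hS
    (fun q hq => (hA q (hSU hq)).hasFDerivWithinAt) ((injOn_position hj hC).mono hSU)]
  refine setLIntegral_congr_fun hS fun q hq => ?_
  rw [← ENNReal.ofReal_mul (abs_nonneg _), hdet q (hSU hq)]

theorem flowMeasure_image_some (hj : IsCurrent C j) (hC : IsOpen C) {B : Set C}
    (hB : MeasurableSet B) :
    flowMeasure C j t (some '' B) = densityMeasure C j t (B ∩ flowImage C j t) := by
  rw [flowMeasure, Measure.map_apply (measurable_flow hj hC) (measurableSet_image_some hB)]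
  rcases eq_or_ne t 0 with rfl | ht
  · rw [flow_zero hj hC, preimage_image_eq _ (Option.some_injective _)]
    congr 1
    ext x
    simp [flowImage, flow_zero hj hC]
  have hS := measurableSet_inter_position_preimage (t := t) hj hC
    (hC.measurableSet.subtype_image hB)
  rw [densityMeasure_apply hC (hB.inter (measurableSet_flowImage hj hC)),
    val_image_inter_flowImage hj hC ht, lintegral_position_image hj hC hS inter_subset_left,
    preimage_flow_image_some hj hC ht,
    densityMeasure_apply hC (hS.preimage measurable_subtype_coe), Subtype.image_preimage_coe,
    inter_eq_self_of_subset_right (inter_subset_left.trans flowDomain_subset)]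

end BohmFlow
end

theorem mainTheorem2 (d : ℕ) (C : Set (BohmFlow.Space d))
    (hC : BohmFlow.IsConfigurationSpace C)
    (j : ℝ × BohmFlow.Space d → ℝ × BohmFlow.Space d)
    (hj : BohmFlow.IsCurrent C j) (t : ℝ) :
    Measurable (BohmFlow.flow C j t) ∧
    MeasurableSet (BohmFlow.flowImage C j t) ∧
    ∀ B : Set C, MeasurableSet B →
      BohmFlow.flowMeasure C j t (some '' B) =
        BohmFlow.densityMeasure C j t (B ∩ BohmFlow.flowImage C j t) :=
  ⟨BohmFlow.measurable_flow hj hC.isOpen, BohmFlow.measurableSet_flowImage hj hC.isOpen,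
    fun _ hB => BohmFlow.flowMeasure_image_some hj hC.isOpen hB⟩
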